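/- Let $K$ be an algebraically closed field of arbitrary characteristic, $n\ge 1$, $K[[x]]=K[[x_1,\dots,x_n]]$ with maximal ideal $\mathfrak m$. **Piecewise filtration.** A $C$-polytope $P$ is given by a non-empty finite irredundant set of weight vectors $w_1,\dots,w_k\in\mathbb Q_{>0}^n$: put $\lambda_P(r)=\min_i\,(w_i\cdot r)$ for $r\in\mathbb R^n$, where irredundant means that no $w_i$ can be omitted in this definition, and $P=\{r\in\mathbb R^n_{\ge 0}\mid\lambda_P(r)=1\}$. Let $N_P$ be the least common multiple of the denominators of all entries of the $w_i$. For $f=\sum_\alpha a_\alpha x^\alpha\in K[[x]]$ put $v_P(f)=\min\{N_P\lambda_P(\alpha)\mid a_\alpha\ne 0\}$ and $v_P(0)=\infty$; for a derivation $\xi=\sum_{i,\alpha}a_{i,\alpha}x^\alpha\partial_{x_i}$ of $K[[x]]$ put $v_P(\xi)=\min\{N_P\lambda_P(\alpha-e_i)\mid a_{i,\alpha}\neq 0\}$ and $v_P(0)=\infty$. Let $F_d=\{g\mid v_P(g)\ge d\}$, and let $\mathrm{In}_P(f)$ be the sum of the terms $a_\alpha x^\alpha$ of $f$ with $a_\alpha\neq0$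 and $\lambda_P(\alpha)$ minimal. **Conditions.** Let $\mathrm j(f)=\langle f_{x_1},\dots,f_{x_n}\rangle$, $M_f=K[[x]]/\mathrm j(f)$ and $\mu(f)=\dim_K M_f$. Put $\mathrm j^A_P(f)_d=\{\xi f\mid v_P(\xi)+v_P(f)\ge d\}$ and $$\mathrm{gr}^A_P(M_f)=\bigoplus_{d\ge 0}F_d/\big(\mathrm j^A_P(f)_d+F_{d+1}\big).$$ One says that $f$ satisfies condition AA with respect to $P$ if $\dim_K\mathrm{gr}^A_P(M_f)<\infty$, and that $f$ is rSPH (right semi-piecewise homogeneous) with respect to $P$ if $\mu(\mathrm{In}_P(f))<\infty$. A regular basis for $M_f$ is a set of monomials $x^\alpha$ whose classes (in degree $v_P(x^\alpha)$) form a $K$-basis of $\mathrm{gr}^A_P(M_f)$. **Equivalence.** Write $f\sim_r g$ if $f=\varphi(g)$ for some $K$-algebra automorphism $\varphi$ of $K[[x]]$. The series $f$ is finitely right determined if there is a $k$ such that $f\sim_r g$ for every $g\in K[[x]]$ which has the same terms as $f$ in all degrees $\le k$. **Corollary 4.5 (Normal forms for right equivalence).** Let $P$ be a $C$-polytope and let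 $f\in\mathfrak m$ be such that $\mathrm{In}_P(f)$ satisfies AA with respect to $P$. Then $f$ is finitely right determined and rSPH with respect to $P$. Moreover, a regular basis for $M_{\mathrm{In}_P(f)}$ exists, every such basis $B$ is finite, and for every such $B$ there are $c_\alpha\in K$ with $$f\;\sim_r\;\mathrm{In}_P(f)+\sum_{x^\alpha\in B,\ v_P(x^\alpha)>d}c_\alpha x^\alpha,\qquad d=v_P(\mathrm{In}_P(f)).$$ -/

import Mathlib

open scoped DirectSum

/-- A `C`-polytope in `ℝ^n`, given by its weight vectors: a non-empty finite set of vectors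
`w ∈ ℚ_{>0}^n` which is irredundant, i.e. no linear function `r ↦ w · r` on `ℝ^n` can be left out
in the definition of `λ(r) = min_w (w · r)`.  The polytope itself is
`{r ∈ ℝ_{≥0}^n | λ(r) = 1}`, see `CPolytope.carrier`. -/
structure CPolytope (n : ℕ) where
  weights : Finset (Fin n → ℚ)
  nonempty : weights.Nonempty
  pos : ∀ w ∈ weights, ∀ i, 0 < w i
  irredundant : ∀ w ∈ weights, ∃ r : Fin n → ℝ, ∀ w' ∈ weights, w' ≠ w →
    ∑ i, (w i : ℝ) * r i < ∑ i, (w' i : ℝ) * r i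

namespace CPolytope

variable {n : ℕ} (P : CPolytope n)

/-- The piecewise linear function `λ_P` on `ℝ^n`. -/
noncomputable def lamReal (r : Fin n → ℝ) : ℝ :=
  P.weights.inf' P.nonempty fun w => ∑ i, (w i : ℝ) * r i

/-- The polytope as a subset of `ℝ^n`. -/
def carrier : Set (Fin n → ℝ) := {r | (∀ i, 0 ≤ r i) ∧ P.lamReal r = 1}

/-- The piecewise linear function `λ_P` on integer vectors. -/
def lam (β : Fin n → ℤ) : ℚ :=
  P.weights.inf' P.nonempty fun w => ∑ i, w i * (β i : ℚ)

theorem lamReal_intCast (β : Fin n → ℤ) :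
    P.lamReal (fun i => (β i : ℝ)) = ((P.lam β : ℚ) : ℝ) := by
  unfold lamReal lam
  rw [Finset.apply_inf'_eq_inf'_comp P.nonempty (fun q : ℚ => (q : ℝ))
    (fun x y => Rat.cast_min x y)]
  refine Finset.inf'_congr _ rfl fun w _ => ?_
  simp

/-- The least common multiple `N_P` of the denominators of all entries of the weight vectors. -/
def N : ℕ := P.weights.lcm fun w => Finset.univ.lcm fun i => (w i).den

/-- The integer `N_P · λ_P(β)` (see `CPolytope.cast_val`). -/
def val (β : Fin n → ℤ) : ℤ := ⌊(P.N : ℚ) * P.lam β⌋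

theorem exists_int_weight {w : Fin n → ℚ} (hw : w ∈ P.weights) (β : Fin n → ℤ) :
    ∃ z : ℤ, (P.N : ℚ) * ∑ i, w i * (β i : ℚ) = z := by
  have h : ∀ i, ∃ z : ℤ, (P.N : ℚ) * w i = z := fun i => by
    have hd : (w i).den ∣ P.N :=
      (Finset.dvd_lcm (f := fun i => (w i).den) (Finset.mem_univ i)).trans
        (Finset.dvd_lcm (f := fun w : Fin n → ℚ => Finset.univ.lcm fun i => (w i).den) hw)
    obtain ⟨c, hc⟩ := hd
    refine ⟨c * (w i).num, ?_⟩
    have := Rat.den_mul_eq_num (w i)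
    rw [hc]
    push_cast
    rw [← this]
    ring
  choose z hz using h
  refine ⟨∑ i, z i * β i, ?_⟩
  push_cast
  rw [Finset.mul_sum]
  refine Finset.sum_congr rfl fun i _ => ?_
  rw [← hz i]
  ring

theorem cast_val (β : Fin n → ℤ) : ((P.val β : ℤ) : ℚ) = P.N * P.lam β := by
  obtain ⟨w, hw, hw'⟩ := Finset.exists_mem_eq_inf' P.nonempty
    (fun w : Fin n → ℚ => ∑ i, w i * (β i : ℚ))
  obtain ⟨z, hz⟩ := P.exists_int_weight hw β
  have h : (P.N : ℚ) * P.lam β = z := by rw [← hz, lam, hw']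
  rw [val, h, Int.floor_intCast]

theorem lam_superadditive (β γ : Fin n → ℤ) : P.lam β + P.lam γ ≤ P.lam (β + γ) := by
  refine Finset.le_inf' _ _ fun w hw => ?_
  have h1 : P.lam β ≤ ∑ i, w i * (β i : ℚ) := Finset.inf'_le _ hw
  have h2 : P.lam γ ≤ ∑ i, w i * (γ i : ℚ) := Finset.inf'_le _ hw
  have h3 : ∑ i, w i * ((β + γ) i : ℚ) = ∑ i, w i * (β i : ℚ) + ∑ i, w i * (γ i : ℚ) := by
    rw [← Finset.sum_add_distrib]
    exact Finset.sum_congr rfl fun i _ => by simp [mul_add]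
  linarith

theorem val_superadditive (β γ : Fin n → ℤ) : P.val β + P.val γ ≤ P.val (β + γ) := by
  have h : ((P.val β + P.val γ : ℤ) : ℚ) ≤ (P.val (β + γ) : ℤ) := by
    push_cast
    rw [cast_val, cast_val, cast_val, ← mul_add]
    exact mul_le_mul_of_nonneg_left (P.lam_superadditive β γ) (Nat.cast_nonneg _)
  exact_mod_cast h

/-- The exponent of the monomial `x^α` as an integer vector. -/
def expo (α : Fin n →₀ ℕ) : Fin n → ℤ := fun i => (α i : ℤ)

theorem lam_expo_nonneg (α : Fin n →₀ ℕ) : 0 ≤ P.lam (expo α) :=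
  Finset.le_inf' _ _ fun w hw => Finset.sum_nonneg fun i _ =>
    mul_nonneg (P.pos w hw i).le (by simp [expo])

theorem val_expo_nonneg (α : Fin n →₀ ℕ) : 0 ≤ P.val (expo α) :=
  Int.floor_nonneg.2 (mul_nonneg (Nat.cast_nonneg _) (P.lam_expo_nonneg α))

/-- The value of `x^α ∂_{x_i}` is that of the exponent `α - e_i`. -/
def valDer (α : Fin n →₀ ℕ) (i : Fin n) : ℤ := P.val (expo α - Pi.single i 1)

theorem valDer_bddBelow : ∃ b : ℤ, ∀ α i, b ≤ P.valDer α i := by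
  refine ⟨-∑ i, |P.val (-Pi.single i 1)|, fun α i => ?_⟩
  have h1 := P.val_superadditive (expo α) (-Pi.single i 1)
  have h2 := P.val_expo_nonneg α
  have h3 : |P.val (-Pi.single i 1)| ≤ ∑ i, |P.val (-Pi.single i 1)| :=
    Finset.single_le_sum (f := fun i => |P.val (-Pi.single i 1)|)
      (fun j _ => abs_nonneg _) (Finset.mem_univ i)
  have h4 := neg_abs_le (P.val (-Pi.single i 1))
  rw [valDer, sub_eq_add_neg]
  linarith

end CPolytope

section Milnor

variable {n : ℕ} {K : Type*} [Field K]

/-- Right equivalence: `f = φ(g)` for an automorphism `φ` of the `K`-algebra `K[[x]]`. -/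
def RightEquiv (f g : MvPowerSeries (Fin n) K) : Prop :=
  ∃ φ : MvPowerSeries (Fin n) K ≃ₐ[K] MvPowerSeries (Fin n) K, f = φ g

/-- `f` is right `k`-determined: it is right equivalent to every `g` with the same terms of
total degree at most `k`. -/
def RightDetermined (k : ℕ) (f : MvPowerSeries (Fin n) K) : Prop :=
  ∀ g : MvPowerSeries (Fin n) K,
    (∀ α : Fin n →₀ ℕ, α.degree ≤ k → MvPowerSeries.coeff α g = MvPowerSeries.coeff α f) →
      RightEquiv f g

/-- `f` is finitely right determined. -/
def FinitelyRightDetermined (f : MvPowerSeries (Fin n) K) : Prop :=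
  ∃ k : ℕ, RightDetermined k f

/-- The Jacobian ideal `j(f) = ⟨f_{x_1}, …, f_{x_n}⟩`. -/
noncomputable def jacobianIdeal (f : MvPowerSeries (Fin n) K) : Ideal (MvPowerSeries (Fin n) K) :=
  Ideal.span (Set.range fun i => MvPowerSeries.pderiv K i f)

/-- The Milnor algebra `M_f = K[[x]] / j(f)`. -/
abbrev MilnorAlgebra (f : MvPowerSeries (Fin n) K) : Type _ :=
  MvPowerSeries (Fin n) K ⧸ jacobianIdeal f

/-- The Milnor number `μ(f) = dim_K M_f`. -/
noncomputable def milnorNumber (f : MvPowerSeries (Fin n) K) : Cardinal :=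
  Module.rank K (MilnorAlgebra f)

/-- The derivation `∑ a_i ∂_{x_i}` of `K[[x]]`.  Every `K`-linear derivation of `K[[x]]` is of
this form for exactly one tuple `(a_1, …, a_n)` of power series. -/
noncomputable def der (a : Fin n → MvPowerSeries (Fin n) K) :
    Derivation K (MvPowerSeries (Fin n) K) (MvPowerSeries (Fin n) K) :=
  ∑ i, a i • MvPowerSeries.pderiv K i

theorem der_apply (a : Fin n → MvPowerSeries (Fin n) K) (f : MvPowerSeries (Fin n) K) :
    der a f = ∑ i, a i * MvPowerSeries.pderiv K i f := by
  have h : ∀ s : Finset (Fin n), (∑ i ∈ s, a i • MvPowerSeries.pderiv K i) f =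
      ∑ i ∈ s, a i * MvPowerSeries.pderiv K i f := fun s => by
    classical
    induction s using Finset.induction_on with
    | empty => simp
    | insert i s hi ih => rw [Finset.sum_insert hi, Finset.sum_insert hi, Derivation.add_apply, ih,
        Derivation.smul_apply, smul_eq_mul]
  exact h Finset.univ

end Milnor

namespace CPolytope

variable {n : ℕ} (P : CPolytope n) {K : Type*} [Field K]

/-- The piecewise valuation `v_P(f) = min {N_P · λ_P(α) | a_α ≠ 0}`, with `v_P(0) = ∞`. -/
noncomputable def v (f : MvPowerSeries (Fin n) K) : WithTop ℤ :=
  ⨅ α : {α : Fin n →₀ ℕ // MvPowerSeries.coeff α f ≠ 0}, (P.val (expo α.1) : WithTop ℤ)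

/-- The extension of `v_P` to derivations: for `ξ = ∑ a_{i,α} x^α ∂_{x_i}` it is
`min {N_P · λ_P(α - e_i) | a_{i,α} ≠ 0}`, and `∞` for `ξ = 0`. -/
noncomputable def vDer (a : Fin n → MvPowerSeries (Fin n) K) : WithTop ℤ :=
  ⨅ p : {p : (Fin n →₀ ℕ) × Fin n // MvPowerSeries.coeff p.1 (a p.2) ≠ 0},
    (P.valDer p.1.1 p.1.2 : WithTop ℤ)

theorem le_iInf_withTop {ι : Type*} (u : ι → ℤ) (b : ℤ) (hb : ∀ i, b ≤ u i) (c : WithTop ℤ) :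
    c ≤ ⨅ i, (u i : WithTop ℤ) ↔ ∀ i, c ≤ u i := by
  have hbdd : BddBelow (Set.range fun i => (u i : WithTop ℤ)) :=
    ⟨(b : WithTop ℤ), by rintro _ ⟨i, rfl⟩; exact WithTop.coe_le_coe.2 (hb i)⟩
  refine ⟨fun h i => h.trans (ciInf_le hbdd i), fun h => ?_⟩
  rcases isEmpty_or_nonempty ι with hι | hι
  · rw [WithTop.iInf_empty]
    exact le_top
  · exact le_ciInf h

theorem le_v_iff (c : WithTop ℤ) (f : MvPowerSeries (Fin n) K) :
    c ≤ P.v f ↔ ∀ α, MvPowerSeries.coeff α f ≠ 0 → c ≤ P.val (expo α) := by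
  unfold v
  rw [le_iInf_withTop (fun α : {α : Fin n →₀ ℕ // MvPowerSeries.coeff α f ≠ 0} =>
    P.val (expo α.1)) 0 fun α => P.val_expo_nonneg α.1]
  exact ⟨fun h α hα => h ⟨α, hα⟩, fun h α => h α.1 α.2⟩

theorem le_vDer_iff (c : WithTop ℤ) (a : Fin n → MvPowerSeries (Fin n) K) :
    c ≤ P.vDer a ↔ ∀ α i, MvPowerSeries.coeff α (a i) ≠ 0 → c ≤ P.valDer α i := by
  obtain ⟨b, hb⟩ := P.valDer_bddBelow
  unfold vDer
  rw [le_iInf_withTop (fun p : {p : (Fin n →₀ ℕ) × Fin n //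
    MvPowerSeries.coeff p.1 (a p.2) ≠ 0} => P.valDer p.1.1 p.1.2) b fun p => hb p.1.1 p.1.2]
  exact ⟨fun h α i hα => h ⟨(α, i), hα⟩, fun h p => h p.1.1 p.1.2 p.2⟩

theorem v_monomial (α : Fin n →₀ ℕ) :
    P.v (MvPowerSeries.monomial α (1 : K)) = P.val (expo α) := by
  refine le_antisymm ?_ ((P.le_v_iff _ _).2 fun β hβ => ?_)
  · exact (P.le_v_iff _ _).1 le_rfl α (by simp)
  · classical
    rw [MvPowerSeries.coeff_monomial] at hβ
    have : β = α := by
      by_contra h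
      simp [h] at hβ
    rw [this]

variable (K) in
/-- The ideal `F_d = {f | v_P(f) ≥ d}`. -/
noncomputable def F (d : ℕ) : Ideal (MvPowerSeries (Fin n) K) where
  carrier := {f | ((d : ℤ) : WithTop ℤ) ≤ P.v f}
  zero_mem' := (P.le_v_iff _ _).2 fun α h => absurd (by simp) h
  add_mem' := fun {f g} hf hg => (P.le_v_iff _ _).2 fun α h => by
    by_cases hfα : MvPowerSeries.coeff α f = 0
    · refine (P.le_v_iff _ _).1 hg α fun h' => h ?_
      rw [map_add, hfα, h', add_zero]
    · exact (P.le_v_iff _ _).1 hf α hfα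
  smul_mem' := fun g f hf => (P.le_v_iff _ _).2 fun α h => by
    classical
    rw [smul_eq_mul, MvPowerSeries.coeff_mul] at h
    obtain ⟨⟨β, γ⟩, hp, hne⟩ := Finset.exists_ne_zero_of_sum_ne_zero h
    have h1 := (P.le_v_iff _ _).1 hf γ (right_ne_zero_of_mul hne)
    have h2 := P.val_superadditive (expo β) (expo γ)
    have h3 : expo β + expo γ = expo α := by
      rw [← Finset.HasAntidiagonal.mem_antidiagonal.1 hp]
      funext i
      simp [expo]
    have h4 := P.val_expo_nonneg β
    rw [h3] at h2
    refine h1.trans ?_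
    exact_mod_cast (by linarith : P.val (expo γ) ≤ P.val (expo α))

/-- The ideal `j_P^A(f)_d = {ξ f | v_P(ξ) + v_P(f) ≥ d}`. -/
noncomputable def jA (f : MvPowerSeries (Fin n) K) (d : ℕ) :
    Ideal (MvPowerSeries (Fin n) K) where
  carrier := {g | ∃ a : Fin n → MvPowerSeries (Fin n) K,
    ((d : ℤ) : WithTop ℤ) ≤ P.vDer a + P.v f ∧ der a f = g}
  zero_mem' := by
    refine ⟨0, ?_, by simp [der_apply]⟩
    have : P.vDer (0 : Fin n → MvPowerSeries (Fin n) K) = ⊤ :=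
      top_le_iff.1 ((P.le_vDer_iff _ _).2 fun α i h => absurd (by simp) h)
    rw [this, top_add]
    exact le_top
  add_mem' := by
    rintro _ _ ⟨a, ha, rfl⟩ ⟨b, hb, rfl⟩
    refine ⟨a + b, ?_, by simp [der_apply, add_mul, Finset.sum_add_distrib]⟩
    have hmin : min (P.vDer a) (P.vDer b) ≤ P.vDer (a + b) :=
      (P.le_vDer_iff _ _).2 fun α i h => by
        by_cases haα : MvPowerSeries.coeff α (a i) = 0
        · refine (min_le_right _ _).trans ((P.le_vDer_iff _ _).1 le_rfl α i fun h' => h ?_)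
          rw [Pi.add_apply, map_add, haα, h', add_zero]
        · exact (min_le_left _ _).trans ((P.le_vDer_iff _ _).1 le_rfl α i haα)
    refine le_trans ?_ (add_le_add_left hmin (P.v f))
    rcases min_choice (P.vDer a) (P.vDer b) with h | h <;> rw [h]
    · exact ha
    · exact hb
  smul_mem' := by
    rintro g _ ⟨a, ha, rfl⟩
    refine ⟨fun i => g * a i, ha.trans (add_le_add_left ?_ (P.v f)), by
      simp [der_apply, Finset.mul_sum, mul_assoc]⟩
    refine (P.le_vDer_iff _ _).2 fun α i h => ?_
    classical
    rw [MvPowerSeries.coeff_mul] at h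
    obtain ⟨⟨β, γ⟩, hp, hne⟩ := Finset.exists_ne_zero_of_sum_ne_zero h
    have h1 := (P.le_vDer_iff _ _).1 le_rfl γ i (right_ne_zero_of_mul hne)
    have h2 := P.val_superadditive (expo β) (expo γ - Pi.single i 1)
    have h3 : expo β + (expo γ - Pi.single i 1) = expo α - Pi.single i 1 := by
      rw [← Finset.HasAntidiagonal.mem_antidiagonal.1 hp]
      funext j
      simp [expo]
      ring
    have h4 := P.val_expo_nonneg β
    rw [h3] at h2
    refine h1.trans ?_
    unfold valDer
    exact_mod_cast (by linarith : P.val (expo γ - Pi.single i 1) ≤ P.val (expo α - Pi.single i 1))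

/-- The principal part `In_P(f)`: the sum of the terms `a_α x^α` of `f` for which `λ_P(α)` is
minimal on the support of `f`. -/
noncomputable def inP (f : MvPowerSeries (Fin n) K) : MvPowerSeries (Fin n) K :=
  open Classical in
  fun α => if ∀ β, MvPowerSeries.coeff β f ≠ 0 → P.lam (expo α) ≤ P.lam (expo β)
    then MvPowerSeries.coeff α f else 0

/-- `f` is right semi-piecewise homogeneous (rSPH) with respect to `P`. -/
def IsRSPH (f : MvPowerSeries (Fin n) K) : Prop := milnorNumber (P.inP f) < Cardinal.aleph0

/-- The degree `d` part `F_d / (j_P^A(f)_d + F_{d+1})` of `gr_P^A(M_f)`. -/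
abbrev grPiece (f : MvPowerSeries (Fin n) K) (d : ℕ) : Type _ :=
  ↥(P.F K d) ⧸ (P.jA f d ⊔ P.F K (d + 1)).submoduleOf (P.F K d)

/-- `gr_P^A(M_f)` as a vector space over `K`. -/
abbrev gr (f : MvPowerSeries (Fin n) K) : Type _ := ⨁ d : ℕ, P.grPiece f d

/-- Condition AA: `gr_P^A(M_f)` has finite dimension over `K`. -/
def SatisfiesAA (f : MvPowerSeries (Fin n) K) : Prop := Module.Finite K (P.gr f)

theorem monomial_mem_F (α : Fin n →₀ ℕ) :
    MvPowerSeries.monomial α (1 : K) ∈ P.F K (P.val (expo α)).toNat := by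
  change _ ≤ P.v _
  rw [v_monomial, Int.toNat_of_nonneg (P.val_expo_nonneg α)]

/-- The class of the monomial `x^α` in `gr_P^A(M_f)`, an element of degree `v_P(x^α)`. -/
noncomputable def monomialClass (f : MvPowerSeries (Fin n) K) (α : Fin n →₀ ℕ) : P.gr f :=
  DirectSum.of (P.grPiece f) (P.val (expo α)).toNat
    (Submodule.Quotient.mk ⟨MvPowerSeries.monomial α (1 : K), P.monomial_mem_F α⟩)

/-- `{x^α | α ∈ Λ}` is a regular basis for `M_f` with respect to `P`: the classes of its elements
form a basis of the `K`-vector space `gr_P^A(M_f)`. -/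
def IsRegularBasis (f : MvPowerSeries (Fin n) K) (Λ : Set (Fin n →₀ ℕ)) : Prop :=
  LinearIndependent K (fun α : Λ => P.monomialClass f α.1) ∧
    Submodule.span K (P.monomialClass f '' Λ) = ⊤

end CPolytope

/-! ### Values of exponents and the shifted filtrations. -/

namespace CPolytope

variable {n : ℕ} (P : CPolytope n)

/-! Let `f₀` be the principal part of `f` and `d` its value. Condition AA makes the graded pieces
vanish in large degrees, i.e. `F_e ⊆ j_P^A(f₀)_e + F_{e+1}` for `e ≥ D`. For `e > d`, an element of
`j_P^A(f₀)_e` is `ξ f₀` with `ξ = ∑ a_i ∂_{x_i}` of value at least `e - d > 0`. The substitution `x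
↦ x - a` is then an automorphism, and it changes every `g ∈ f₀ + F_{d+1}` by `-ξ f₀` modulo
`F_{e+1}` (`substAdd_neg_sub_add_der_mem`). This rests on a first order Taylor formula with
quadratic remainder (`substAdd_sub_self_sub_der_mem`), which holds in every characteristic.

Hence terms of large value can be removed degree by degree, and the composed substitutions converge
(`rightEquiv_of_sub_mem`). Since degrees are bounded by values, this is finite determinacy. The same
successive approximation, applied to derivations, puts some `F_e` into the Jacobian ideal of `f₀`
(`F_le_jacobianIdeal`), so that its Milnor number is finite.

For the normal form, the error in each degree above `d` is a combination of basis monomials plus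
some `ξ f₀`: the former are kept, the latter removed (`exists_rightEquiv_sub_mem`). Finitely many
degrees suffice, as determinacy absorbs the rest. -/

theorem N_pos : 0 < P.N := by
  refine Nat.pos_of_ne_zero fun h => ?_
  rw [N, Finset.lcm_eq_zero_iff] at h
  obtain ⟨w, -, hw⟩ := h
  rw [Finset.lcm_eq_zero_iff] at hw
  obtain ⟨i, -, hi⟩ := hw
  exact (w i).den_nz hi

theorem lam_le_lam_iff (β γ : Fin n → ℤ) : P.lam β ≤ P.lam γ ↔ P.val β ≤ P.val γ := by
  have hN : (0 : ℚ) < P.N := Nat.cast_pos.2 P.N_pos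
  rw [← Int.cast_le (R := ℚ), cast_val, cast_val]
  exact (mul_le_mul_iff_right₀ hN).symm

theorem expo_zero : expo (0 : Fin n →₀ ℕ) = 0 := by
  funext i; simp [expo]

theorem expo_add (α β : Fin n →₀ ℕ) : expo (α + β) = expo α + expo β := by
  funext i; simp [expo]

theorem expo_single (i : Fin n) : expo (Finsupp.single i 1) = Pi.single i 1 := by
  classical
  funext j
  simp [expo, Finsupp.single_apply, Pi.single_apply, eq_comm]

theorem val_zero : P.val 0 = 0 := by
  have : P.lam 0 = 0 := by simp [lam]
  simp [val, this]

theorem one_le_val_single (i : Fin n) : 1 ≤ P.val (Pi.single i 1) := by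
  have h : (0 : ℚ) < (P.val (Pi.single i 1) : ℤ) := by
    rw [cast_val]
    refine mul_pos (Nat.cast_pos.2 P.N_pos) ((Finset.lt_inf'_iff _).2 fun w hw => ?_)
    simpa [Pi.single_apply] using P.pos w hw i
  exact_mod_cast h

/-- Each variable has a positive integer as value, and values are superadditive. So large degree
forces large value, and only finitely many monomials lie below a given value. -/
theorem degree_le_val (α : Fin n →₀ ℕ) : (α.degree : ℤ) ≤ P.val (expo α) := by
  induction α using Finsupp.induction_linear with
  | zero =>
    simp [expo_zero, val_zero]
  | add f g hf hg =>
    rw [expo_add, map_add]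
    have := P.val_superadditive (expo f) (expo g)
    push_cast
    linarith
  | single i m =>
    induction m with
    | zero =>
      simp [expo_zero, val_zero]
    | succ m ih =>
      rw [Finsupp.single_add, expo_add, map_add, expo_single]
      have := P.val_superadditive (expo (Finsupp.single i m)) (Pi.single i 1)
      have := P.one_le_val_single i
      simp only [Finsupp.degree_single] at ih ⊢
      push_cast
      linarith

theorem finite_val_lt (m : ℤ) : {α : Fin n →₀ ℕ | P.val (expo α) < m}.Finite := by
  refine (Finsupp.finite_of_degree_le (σ := Fin n) m.toNat).subset fun α hα => ?_
  have := P.degree_le_val α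
  simp only [Set.mem_ofPred_eq] at hα ⊢
  omega

variable (K : Type*) [Field K]

/-- The space of all series whose exponents `β` satisfy `N_P · λ_P(β + γ) ≥ e`. -/
noncomputable def shiftedF (γ : Fin n → ℤ) (e : ℤ) : Submodule K (MvPowerSeries (Fin n) K) where
  carrier := {g | ∀ β, MvPowerSeries.coeff β g ≠ 0 → e ≤ P.val (expo β + γ)}
  zero_mem' := fun β h => absurd (by simp) h
  add_mem' := fun {f g} hf hg β h => by
    by_cases hfβ : MvPowerSeries.coeff β f = 0
    · refine hg β fun h' => h ?_
      rw [map_add, hfβ, h', add_zero]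
    · exact hf β hfβ
  smul_mem' := fun c f hf β h => hf β fun h' => h (by simp [h'])

variable {K} {P} {γ δ : Fin n → ℤ} {d e k : ℤ} {a b : Fin n → MvPowerSeries (Fin n) K}
  {f g : MvPowerSeries (Fin n) K}

theorem mem_shiftedF :
    g ∈ P.shiftedF K γ e ↔ ∀ β, MvPowerSeries.coeff β g ≠ 0 → e ≤ P.val (expo β + γ) := Iff.rfl

theorem coeff_eq_zero_of_mem_shiftedF (h : g ∈ P.shiftedF K γ e) {β : Fin n →₀ ℕ}
    (hβ : P.val (expo β + γ) < e) : MvPowerSeries.coeff β g = 0 := by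
  by_contra h'
  exact absurd (h β h') (not_le.2 hβ)

theorem coe_le_v_iff : (e : WithTop ℤ) ≤ P.v g ↔ g ∈ P.shiftedF K 0 e := by
  rw [le_v_iff, mem_shiftedF]
  simp

theorem mem_F_iff {m : ℕ} : g ∈ P.F K m ↔ g ∈ P.shiftedF K 0 m := coe_le_v_iff

theorem coe_le_vDer_iff :
    (e : WithTop ℤ) ≤ P.vDer a ↔ ∀ i, a i ∈ P.shiftedF K (-Pi.single i 1) e := by
  simp only [le_vDer_iff, mem_shiftedF, WithTop.coe_le_coe, valDer, sub_eq_add_neg]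
  exact forall_comm

theorem shiftedF_anti (h : d ≤ e) : P.shiftedF K γ e ≤ P.shiftedF K γ d :=
  fun _ hg β hβ => h.trans (hg β hβ)

theorem shiftedF_le (h : d ≤ e + P.val (δ - γ)) : P.shiftedF K γ e ≤ P.shiftedF K δ d := by
  intro g hg β hβ
  have h1 := hg β hβ
  have h2 := P.val_superadditive (expo β + γ) (δ - γ)
  rw [show expo β + γ + (δ - γ) = expo β + δ by abel] at h2
  linarith

theorem mul_mem_shiftedF (hf : f ∈ P.shiftedF K γ d) (hg : g ∈ P.shiftedF K δ e) :
    f * g ∈ P.shiftedF K (γ + δ) (d + e) := by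
  classical
  intro β h
  rw [MvPowerSeries.coeff_mul] at h
  obtain ⟨⟨β₁, β₂⟩, hp, hne⟩ := Finset.exists_ne_zero_of_sum_ne_zero h
  have h1 := hf β₁ (left_ne_zero_of_mul hne)
  have h2 := hg β₂ (right_ne_zero_of_mul hne)
  have h3 := P.val_superadditive (expo β₁ + γ) (expo β₂ + δ)
  rw [← Finset.HasAntidiagonal.mem_antidiagonal.1 hp, expo_add]
  rw [show expo β₁ + γ + (expo β₂ + δ) = expo β₁ + expo β₂ + (γ + δ) by abel] at h3
  linarith

theorem pderiv_mem_shiftedF (hg : g ∈ P.shiftedF K γ e) (i : Fin n) :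
    MvPowerSeries.pderiv K i g ∈ P.shiftedF K (γ + Pi.single i 1) e := by
  intro β h
  rw [MvPowerSeries.coeff_pderiv] at h
  have := hg _ (left_ne_zero_of_mul h)
  rwa [expo_add, expo_single, add_right_comm, add_assoc] at this

theorem der_mem_shiftedF (ha : ∀ i, a i ∈ P.shiftedF K (-Pi.single i 1) k)
    (hg : g ∈ P.shiftedF K γ e) : der a g ∈ P.shiftedF K γ (e + k) := by
  rw [der_apply]
  refine Submodule.sum_mem _ fun i _ => ?_
  have := mul_mem_shiftedF (ha i) (pderiv_mem_shiftedF hg i)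
  rwa [show -Pi.single i 1 + (γ + Pi.single i 1) = γ by abel, add_comm k] at this

theorem monomial_mem_shiftedF {α : Fin n →₀ ℕ} (h : e ≤ P.val (expo α + γ)) (c : K) :
    MvPowerSeries.monomial α c ∈ P.shiftedF K γ e := by
  classical
  intro β hβ
  rw [MvPowerSeries.coeff_monomial] at hβ
  obtain rfl : β = α := by
    by_contra h'
    simp [h'] at hβ
  exact h

theorem X_mem_shiftedF (i : Fin n) :
    (MvPowerSeries.X i : MvPowerSeries (Fin n) K) ∈ P.shiftedF K (-Pi.single i 1) 0 :=
  monomial_mem_shiftedF (by rw [expo_single, add_neg_cancel, val_zero]) 1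

/-- The derivation `∂_{x_i}` itself has negative value, because `P.val (-e_i) ≤ -P.val e_i`. -/
theorem constantCoeff_eq_zero_of_mem (hk : 0 < k) {i : Fin n}
    (h : g ∈ P.shiftedF K (-Pi.single i 1) k) : MvPowerSeries.constantCoeff g = 0 := by
  rw [← MvPowerSeries.coeff_zero_eq_constantCoeff_apply]
  refine coeff_eq_zero_of_mem_shiftedF h (hk.trans_le' ?_)
  have h1 := P.val_superadditive (Pi.single i 1) (-Pi.single i 1)
  have h2 := P.one_le_val_single i
  rw [add_neg_cancel, val_zero] at h1
  rw [expo_zero, zero_add]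
  linarith

theorem shiftedF_single_le (i : Fin n) :
    P.shiftedF K (-Pi.single i 1) e ≤ P.shiftedF K 0 e := by
  refine shiftedF_le ?_
  have := P.one_le_val_single i
  rw [sub_neg_eq_add, zero_add]
  linarith

/-- The part of `g` of value less than `m`. -/
noncomputable def truncVal (P : CPolytope n) (m : ℤ) (g : MvPowerSeries (Fin n) K) :
    MvPowerSeries (Fin n) K :=
  ∑ α ∈ (P.finite_val_lt m).toFinset, MvPowerSeries.monomial α (MvPowerSeries.coeff α g)

theorem coeff_truncVal (m : ℤ) (g : MvPowerSeries (Fin n) K) (β : Fin n →₀ ℕ) :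
    MvPowerSeries.coeff β (P.truncVal m g) =
      if P.val (expo β) < m then MvPowerSeries.coeff β g else 0 := by
  classical
  simp [truncVal, map_sum, MvPowerSeries.coeff_monomial]

theorem sub_truncVal_mem (m : ℤ) (g : MvPowerSeries (Fin n) K) :
    g - P.truncVal m g ∈ P.shiftedF K 0 m := by
  intro β h
  rw [map_sub, coeff_truncVal] at h
  rw [add_zero]
  by_contra h'
  simp [not_le.1 h'] at h

theorem eq_zero_of_forall_mem_shiftedF (h : ∀ m : ℕ, g ∈ P.shiftedF K 0 m) : g = 0 := by
  ext β
  refine coeff_eq_zero_of_mem_shiftedF (h ((P.val (expo β)).toNat + 1)) ?_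
  rw [add_zero]
  omega

/-- A linear map which raises values on monomials and does not lower them on series raises
values. -/
theorem map_mem_shiftedF (T : MvPowerSeries (Fin n) K →ₗ[K] MvPowerSeries (Fin n) K)
    (hT : ∀ α, T (MvPowerSeries.monomial α 1) ∈ P.shiftedF K (-expo α) k)
    (hT₀ : ∀ (m : ℤ) g, g ∈ P.shiftedF K 0 m → T g ∈ P.shiftedF K 0 m)
    (hg : g ∈ P.shiftedF K γ e) : T g ∈ P.shiftedF K γ (e + k) := by
  intro β hβ
  -- With this cut-off the discarded tail does not reach the exponent `β`, so `g` may be replaced by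
  -- a finite sum of monomials.
  set m := P.val (expo β) + 1 with hm
  have h1 : MvPowerSeries.coeff β (T (g - P.truncVal m g)) = 0 :=
    coeff_eq_zero_of_mem_shiftedF (hT₀ m _ (sub_truncVal_mem m g)) (by rw [add_zero]; omega)
  rw [map_sub, map_sub, sub_eq_zero] at h1
  rw [h1] at hβ
  refine mem_shiftedF.1 (?_ : T (P.truncVal m g) ∈ P.shiftedF K γ (e + k)) β hβ
  rw [truncVal, map_sum]
  refine Submodule.sum_mem _ fun α _ => ?_
  by_cases hα : MvPowerSeries.coeff α g = 0
  · simp [hα]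
  have h2 : MvPowerSeries.monomial α (MvPowerSeries.coeff α g) =
      MvPowerSeries.coeff α g • MvPowerSeries.monomial α (1 : K) := by
    rw [← map_smul, smul_eq_mul, mul_one]
  rw [h2, map_smul]
  refine Submodule.smul_mem _ _ (shiftedF_le ?_ (hT α))
  have := hg α hα
  rw [sub_neg_eq_add, add_comm γ]
  linarith

/-- If the differences of successive terms tend to zero with respect to `v_P`, a sequence
converges. -/
theorem exists_limit (s : ℕ → MvPowerSeries (Fin n) K)
    (hs : ∀ m : ℕ, s (m + 1) - s m ∈ P.shiftedF K 0 m) :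
    ∃ u, (∀ m : ℕ, u - s m ∈ P.shiftedF K 0 m) ∧
      ∀ β, ∃ m : ℕ, MvPowerSeries.coeff β u = MvPowerSeries.coeff β (s m) := by
  have hs' : ∀ m l : ℕ, s (m + l) - s m ∈ P.shiftedF K 0 m := fun m l => by
    induction l with
    | zero => simp
    | succ l ih =>
      have := add_mem (shiftedF_anti (by simp) (hs (m + l))) ih
      rwa [sub_add_sub_cancel] at this
  -- From this index on, the coefficient at `β` no longer changes.
  let u : MvPowerSeries (Fin n) K :=
    fun β => MvPowerSeries.coeff β (s ((P.val (expo β)).toNat + 1))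
  have hu : ∀ β, MvPowerSeries.coeff β u =
    MvPowerSeries.coeff β (s ((P.val (expo β)).toNat + 1)) := fun β => rfl
  refine ⟨u, fun m β hβ => ?_, fun β => ⟨_, hu β⟩⟩
  rw [add_zero]
  by_contra! hlt
  have h0 := P.val_expo_nonneg β
  obtain ⟨l, rfl⟩ : ∃ l, m = (P.val (expo β)).toNat + 1 + l :=
    ⟨m - ((P.val (expo β)).toNat + 1), by omega⟩
  refine hβ ?_
  rw [map_sub, hu, ← neg_sub, neg_eq_zero, ← map_sub]
  refine coeff_eq_zero_of_mem_shiftedF (hs' _ l) ?_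
  rw [add_zero]
  omega

end CPolytope

/-! ### Substitutions `x ↦ x + a` of positive value. -/

section RightEquivalence

variable {n : ℕ} {K : Type*} [Field K]

/-- The substitution `x ↦ x + a`. -/
noncomputable def substAdd (a : Fin n → MvPowerSeries (Fin n) K) (g : MvPowerSeries (Fin n) K) :
    MvPowerSeries (Fin n) K :=
  MvPowerSeries.subst (fun i => MvPowerSeries.X i + a i) g

theorem rightEquiv_refl (f : MvPowerSeries (Fin n) K) : RightEquiv f f := ⟨AlgEquiv.refl, rfl⟩

theorem RightEquiv.trans {f g h : MvPowerSeries (Fin n) K} (h₁ : RightEquiv f g)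
    (h₂ : RightEquiv g h) : RightEquiv f h := by
  obtain ⟨φ, rfl⟩ := h₁
  obtain ⟨ψ, rfl⟩ := h₂
  exact ⟨ψ.trans φ, rfl⟩

theorem RightEquiv.symm {f g : MvPowerSeries (Fin n) K} (h : RightEquiv f g) :
    RightEquiv g f := by
  obtain ⟨φ, rfl⟩ := h
  exact ⟨φ.symm, by simp⟩

theorem der_X (a : Fin n → MvPowerSeries (Fin n) K) (i : Fin n) :
    der a (MvPowerSeries.X i) = a i := by
  classical
  simp [der_apply, MvPowerSeries.pderiv_X, Pi.single_apply]

end RightEquivalence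

namespace CPolytope

variable {n : ℕ} {P : CPolytope n} {K : Type*} [Field K] {γ δ : Fin n → ℤ} {d e k : ℤ}
  {a b : Fin n → MvPowerSeries (Fin n) K} {f g : MvPowerSeries (Fin n) K}

theorem hasSubst_substAdd (hk : 0 < k) (ha : ∀ i, a i ∈ P.shiftedF K (-Pi.single i 1) k) :
    MvPowerSeries.HasSubst (fun i => MvPowerSeries.X i + a i) :=
  MvPowerSeries.hasSubst_of_constantCoeff_zero fun i => by
    rw [map_add, MvPowerSeries.constantCoeff_X, constantCoeff_eq_zero_of_mem hk (ha i), add_zero]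

theorem X_add_mem_shiftedF (hk : 0 ≤ k) (ha : ∀ i, a i ∈ P.shiftedF K (-Pi.single i 1) k)
    (i : Fin n) : MvPowerSeries.X i + a i ∈ P.shiftedF K (-Pi.single i 1) 0 :=
  add_mem (X_mem_shiftedF i) (shiftedF_anti hk (ha i))

/-- First order Taylor formula: the remainder gains twice the value of the derivation. It is checked
on monomials by multiplicativity, so no factorials are divided by, and extended to series by
`map_mem_shiftedF`. -/
theorem substAdd_sub_self_sub_der_mem (hk : 0 < k)
    (ha : ∀ i, a i ∈ P.shiftedF K (-Pi.single i 1) k) (hg : g ∈ P.shiftedF K γ e) :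
    substAdd a g - g - der a g ∈ P.shiftedF K γ (e + 2 * k) := by
  classical
  have hs := hasSubst_substAdd hk ha
  set φ := MvPowerSeries.substAlgHom (R := K) hs with hφ
  have hφX : ∀ i, φ (MvPowerSeries.X i) = MvPowerSeries.X i + a i := fun i =>
    MvPowerSeries.substAlgHom_X hs i
  have hmon : ∀ α : Fin n →₀ ℕ, φ (MvPowerSeries.monomial α 1) ∈ P.shiftedF K (-expo α) 0 ∧
      φ (MvPowerSeries.monomial α 1) - MvPowerSeries.monomial α 1 -
        der a (MvPowerSeries.monomial α 1) ∈ P.shiftedF K (-expo α) (2 * k) := by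
    intro α
    induction α using Finsupp.induction_linear with
    | zero =>
      rw [MvPowerSeries.monomial_zero_one, map_one, Derivation.map_one_eq_zero, sub_self, sub_zero,
        ← MvPowerSeries.monomial_zero_one]
      exact ⟨monomial_mem_shiftedF (by simp [expo_zero, val_zero]) 1, zero_mem _⟩
    | add α β h₁ h₂ =>
      rw [show MvPowerSeries.monomial (α + β) (1 : K) =
        MvPowerSeries.monomial α 1 * MvPowerSeries.monomial β 1 by
          rw [MvPowerSeries.monomial_mul_monomial, one_mul], map_mul, Derivation.leibniz,
        expo_add, neg_add]
      have hd : ∀ α : Fin n →₀ ℕ, der a (MvPowerSeries.monomial α (1 : K)) ∈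
          P.shiftedF K (-expo α) k := fun α => by
        simpa using der_mem_shiftedF ha
          (monomial_mem_shiftedF (γ := -expo α) (e := 0) (by simp [val_zero]) (1 : K))
      have hm : MvPowerSeries.monomial α (1 : K) ∈ P.shiftedF K (-expo α) 0 :=
        monomial_mem_shiftedF (by simp [val_zero]) 1
      refine ⟨by simpa using mul_mem_shiftedF h₁.1 h₂.1, ?_⟩
      -- For the remainder `R = φ - id - ξ` one has `R(pq) = R(p)φ(q) + p R(q) + ξ(p)ξ(q) +
      -- ξ(p)R(q)`.
      have e1 := mul_mem_shiftedF h₁.2 h₂.1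
      have e2 := mul_mem_shiftedF hm h₂.2
      have e3 := mul_mem_shiftedF (hd α) (hd β)
      have e4 := mul_mem_shiftedF (hd α) h₂.2
      rw [add_zero] at e1
      rw [zero_add] at e2
      rw [← two_mul] at e3
      have := add_mem (add_mem (add_mem e1 e2) e3)
        (shiftedF_anti (by linarith : 2 * k ≤ k + 2 * k) e4)
      convert this using 1
      simp only [smul_eq_mul]
      ring
    | single i m =>
      have hX : ∀ m, MvPowerSeries.monomial (Finsupp.single i m) (1 : K) = MvPowerSeries.X i ^ m :=
        fun m => (MvPowerSeries.X_pow_eq i m).symm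
      have hexp : expo (Finsupp.single i m) = m • Pi.single i 1 := by
        funext j
        simp [expo, Finsupp.single_apply, Pi.single_apply, eq_comm]
      rw [hX, hexp]
      clear hexp
      induction m with
      | zero =>
        simp only [pow_zero, map_one, Derivation.map_one_eq_zero, sub_self, zero_smul, neg_zero]
        refine ⟨?_, zero_mem _⟩
        rw [← MvPowerSeries.monomial_zero_one]
        exact monomial_mem_shiftedF (by simp [expo_zero, val_zero]) 1
      | succ m ih =>
        have hXm : (MvPowerSeries.X i ^ m : MvPowerSeries (Fin n) K) ∈
            P.shiftedF K (-(m • Pi.single i 1)) 0 := by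
          rw [← hX]
          refine monomial_mem_shiftedF (Eq.le ?_) 1
          rw [← P.val_zero]
          congr 1
          funext j
          simp [expo, Finsupp.single_apply, Pi.single_apply, eq_comm]
        have hdm := der_mem_shiftedF ha hXm
        rw [zero_add] at hdm
        rw [pow_succ, map_mul, hφX, Derivation.leibniz, der_X, add_smul, one_smul,
          neg_add]
        have hXa := X_add_mem_shiftedF hk.le ha i
        refine ⟨by simpa using mul_mem_shiftedF ih.1 hXa, ?_⟩
        -- Here the remainder of a variable is zero, and two terms of the product formula are left.
        have e1 := mul_mem_shiftedF ih.2 hXa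
        have e2 := mul_mem_shiftedF hdm (ha i)
        rw [add_zero] at e1
        rw [← two_mul] at e2
        convert add_mem e1 e2 using 1
        simp only [smul_eq_mul]
        ring
  have hφF : ∀ (m : ℤ) g, g ∈ P.shiftedF K 0 m → φ g ∈ P.shiftedF K 0 m := by
    intro m g hg β hβ
    rw [hφ, MvPowerSeries.substAlgHom_apply, MvPowerSeries.coeff_subst hs] at hβ
    obtain ⟨α, hα⟩ := not_forall.1 fun h => hβ (finsum_eq_zero_of_forall_eq_zero h)
    rw [smul_eq_mul] at hα
    have h1 := hg α (left_ne_zero_of_mul hα)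
    have h2 := right_ne_zero_of_mul hα
    have h3 := MvPowerSeries.substAlgHom_monomial hs α (1 : K)
    rw [(algebraMap K (MvPowerSeries (Fin n) K)).map_one, one_mul] at h3
    rw [← h3] at h2
    have h4 := (hmon α).1 β h2
    have h5 := P.val_superadditive (expo α) (expo β + -expo α)
    rw [show expo α + (expo β + -expo α) = expo β by abel] at h5
    rw [add_zero] at h1 ⊢
    linarith
  rw [show substAdd a g = φ g from (MvPowerSeries.substAlgHom_apply hs g).symm]
  refine map_mem_shiftedF (φ.toLinearMap - LinearMap.id - (der a).toLinearMap)
    (fun α => (hmon α).2) (fun m g hg => ?_) hg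
  exact sub_mem (sub_mem (hφF m g hg) hg)
    (shiftedF_anti (by linarith) (der_mem_shiftedF ha hg))

theorem substAdd_sub_self_mem (hk : 0 < k) (ha : ∀ i, a i ∈ P.shiftedF K (-Pi.single i 1) k)
    (hg : g ∈ P.shiftedF K γ e) : substAdd a g - g ∈ P.shiftedF K γ (e + k) := by
  have h := add_mem (shiftedF_anti (by linarith) (substAdd_sub_self_sub_der_mem hk ha hg))
    (der_mem_shiftedF ha hg)
  rwa [sub_add_cancel] at h

theorem substAdd_mem (hk : 0 < k) (ha : ∀ i, a i ∈ P.shiftedF K (-Pi.single i 1) k)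
    (hg : g ∈ P.shiftedF K γ e) : substAdd a g ∈ P.shiftedF K γ e := by
  have h := add_mem (shiftedF_anti (by linarith) (substAdd_sub_self_mem hk ha hg)) hg
  rwa [sub_add_cancel] at h

theorem substAdd_sub (hk : 0 < k) (ha : ∀ i, a i ∈ P.shiftedF K (-Pi.single i 1) k)
    (f g : MvPowerSeries (Fin n) K) : substAdd a (f - g) = substAdd a f - substAdd a g :=
  MvPowerSeries.subst_sub (hasSubst_substAdd hk ha) f g

theorem mem_shiftedF_zero (g : MvPowerSeries (Fin n) K) : g ∈ P.shiftedF K 0 0 :=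
  fun β _ => by simpa using P.val_expo_nonneg β

/-- The linear part of `x + a` need not be the identity, but the substitution differs from the
identity by a map raising values by `k > 0`. So the kernel is zero, and `g ↦ g + (h - φ g)` iterates
to a preimage of `h`. -/
theorem substAdd_bijective (hk : 0 < k) (ha : ∀ i, a i ∈ P.shiftedF K (-Pi.single i 1) k) :
    Function.Bijective (substAdd a) := by
  constructor
  · intro f g hfg
    rw [← sub_eq_zero]
    refine eq_zero_of_forall_mem_shiftedF (P := P) fun m => ?_
    induction m with
    | zero => exact mem_shiftedF_zero _
    | succ m ih =>
      have h := substAdd_sub_self_mem hk ha ih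
      rw [substAdd_sub hk ha, hfg, sub_self, zero_sub] at h
      exact shiftedF_anti (by push_cast; linarith) (neg_mem_iff.1 h)
  · intro h
    let s : ℕ → MvPowerSeries (Fin n) K := fun m => (fun g => g + (h - substAdd a g))^[m] 0
    have hs : ∀ m, s (m + 1) = s m + (h - substAdd a (s m)) := fun m =>
      Function.iterate_succ_apply' _ _ _
    have hm : ∀ m : ℕ, h - substAdd a (s m) ∈ P.shiftedF K 0 m := fun m => by
      induction m with
      | zero => exact mem_shiftedF_zero _
      | succ m ih =>
        have h1 := substAdd_sub_self_mem hk ha ih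
        rw [← neg_mem_iff] at h1
        have h2 : h - substAdd a (s (m + 1)) =
            -(substAdd a (h - substAdd a (s m)) - (h - substAdd a (s m))) := by
          have h3 : substAdd a (s (m + 1)) = substAdd a (s m) +
              substAdd a (h - substAdd a (s m)) := by
            rw [hs]
            exact MvPowerSeries.subst_add (hasSubst_substAdd hk ha) _ _
          rw [h3]
          ring
        rw [h2]
        exact shiftedF_anti (by push_cast; linarith) h1
    obtain ⟨u, hu, -⟩ := exists_limit (P := P) s fun m => by
      rw [hs, add_sub_cancel_left]
      exact hm m
    refine ⟨u, ?_⟩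
    rw [← sub_eq_zero]
    refine eq_zero_of_forall_mem_shiftedF (P := P) fun m => ?_
    have h1 := sub_mem (substAdd_mem hk ha (hu m)) (hm m)
    rwa [substAdd_sub hk ha, sub_sub_sub_cancel_right] at h1

theorem rightEquiv_substAdd (hk : 0 < k) (ha : ∀ i, a i ∈ P.shiftedF K (-Pi.single i 1) k)
    (g : MvPowerSeries (Fin n) K) : RightEquiv (substAdd a g) g := by
  refine ⟨AlgEquiv.ofBijective (MvPowerSeries.substAlgHom (hasSubst_substAdd hk ha)) ?_, ?_⟩
  · rw [MvPowerSeries.coe_substAlgHom]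
    exact substAdd_bijective hk ha
  · rw [AlgEquiv.coe_ofBijective, MvPowerSeries.coe_substAlgHom]
    rfl

/-- A composite is again of the form `x ↦ x + c`, so an infinite composition can be followed through
its tuple `c`. -/
theorem substAdd_substAdd (hk : 0 < k) (ha : ∀ i, a i ∈ P.shiftedF K (-Pi.single i 1) k)
    (hb : ∀ i, b i ∈ P.shiftedF K (-Pi.single i 1) k) (g : MvPowerSeries (Fin n) K) :
    substAdd a (substAdd b g) = substAdd (fun i => a i + substAdd a (b i)) g := by
  unfold substAdd
  rw [MvPowerSeries.subst_comp_subst_apply (hasSubst_substAdd hk hb) (hasSubst_substAdd hk ha)]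
  congr 1
  funext i
  rw [MvPowerSeries.subst_add (hasSubst_substAdd hk ha),
    MvPowerSeries.subst_X (hasSubst_substAdd hk ha), add_assoc]

/-- Continuity in the tuple: modulo the ideal `F_m` the images of the variables agree, hence those
of all monomials. -/
theorem substAdd_sub_substAdd_mem (hk : 0 < k) {m : ℕ}
    (ha : ∀ i, a i ∈ P.shiftedF K (-Pi.single i 1) k)
    (hb : ∀ i, b i ∈ P.shiftedF K (-Pi.single i 1) k) (hab : ∀ i, a i - b i ∈ P.F K m)
    (g : MvPowerSeries (Fin n) K) : substAdd a g - substAdd b g ∈ P.F K m := by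
  have hX : ∀ α : Fin n →₀ ℕ, (α.prod fun i l => (MvPowerSeries.X i + a i) ^ l) -
      (α.prod fun i l => (MvPowerSeries.X i + b i) ^ l) ∈ P.F K m := fun α => by
    rw [← Ideal.Quotient.eq, Finsupp.prod, Finsupp.prod, map_prod, map_prod]
    refine Finset.prod_congr rfl fun i _ => ?_
    rw [map_pow, map_pow]
    congr 1
    rw [Ideal.Quotient.eq, add_sub_add_left_eq_sub]
    exact hab i
  rw [mem_F_iff]
  intro β hβ
  by_contra! h
  refine hβ ?_
  unfold substAdd
  rw [map_sub, MvPowerSeries.coeff_subst (hasSubst_substAdd hk ha),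
    MvPowerSeries.coeff_subst (hasSubst_substAdd hk hb), sub_eq_zero]
  refine finsum_congr fun α => ?_
  congr 1
  rw [← sub_eq_zero, ← map_sub]
  exact coeff_eq_zero_of_mem_shiftedF (mem_F_iff.1 (hX α)) h

end CPolytope

/-! ### Principal parts, condition AA, determinacy and the Milnor number. -/

namespace CPolytope

variable {n : ℕ} {P : CPolytope n} {K : Type*} [Field K] {d e : ℕ}
  {a b : Fin n → MvPowerSeries (Fin n) K} {f f₀ g : MvPowerSeries (Fin n) K}

theorem coeff_inP (f : MvPowerSeries (Fin n) K) (α : Fin n →₀ ℕ) [Decidable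
    (∀ β, MvPowerSeries.coeff β f ≠ 0 → P.lam (expo α) ≤ P.lam (expo β))] :
    MvPowerSeries.coeff α (P.inP f) =
      if ∀ β, MvPowerSeries.coeff β f ≠ 0 → P.lam (expo α) ≤ P.lam (expo β)
      then MvPowerSeries.coeff α f else 0 := by
  classical
  rw [MvPowerSeries.coeff_apply, inP]
  congr

theorem F_anti (h : d ≤ e) : P.F K e ≤ P.F K d := fun _ hg =>
  mem_F_iff.2 (shiftedF_anti (Nat.cast_le.2 h) (mem_F_iff.1 hg))

/-- Values are integers, so the terms outside the principal part have value at least `d + 1`. -/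
theorem exists_v_inP_eq (hf : f ≠ 0) :
    ∃ d : ℕ, P.v (P.inP f) = (d : ℤ) ∧ f - P.inP f ∈ P.F K (d + 1) := by
  classical
  obtain ⟨α, hα, hmin⟩ : ∃ α, MvPowerSeries.coeff α f ≠ 0 ∧
      ∀ β, MvPowerSeries.coeff β f ≠ 0 → P.val (expo α) ≤ P.val (expo β) := by
    let S : Set (Fin n →₀ ℕ) := {α | MvPowerSeries.coeff α f ≠ 0}
    have hS : S.Nonempty := by
      by_contra h
      refine hf (MvPowerSeries.ext fun α => ?_)
      by_contra h'
      exact h ⟨α, h'⟩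
    refine ⟨Function.argminOn (fun α => (P.val (expo α)).toNat) S hS,
      Function.argminOn_mem (fun α => (P.val (expo α)).toNat) S hS, fun β hβ => ?_⟩
    have h1 := Function.argminOn_le (fun α => (P.val (expo α)).toNat) S (a := β) hβ
    have h2 := P.val_expo_nonneg β
    omega
  have h0 := P.val_expo_nonneg α
  refine ⟨(P.val (expo α)).toNat, ?_, ?_⟩
  · rw [Int.toNat_of_nonneg h0]
    refine le_antisymm ((P.le_v_iff _ _).1 le_rfl α ?_) (coe_le_v_iff.2 fun β hβ => ?_)
    · rwa [coeff_inP, if_pos fun β hβ => (P.lam_le_lam_iff _ _).2 (hmin β hβ)]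
    · rw [add_zero]
      refine hmin β fun h => hβ ?_
      rw [coeff_inP, h, ite_self]
  · rw [mem_F_iff]
    intro β hβ
    rw [map_sub, coeff_inP] at hβ
    rw [add_zero]
    split_ifs at hβ with h
    · simp at hβ
    · simp only [sub_zero] at hβ
      by_contra! h'
      refine h fun γ hγ => (P.lam_le_lam_iff _ _).2 (le_trans ?_ (hmin γ hγ))
      push_cast at h'
      omega

/-- Finitely many generators of the graded space live in bounded degrees. -/
theorem exists_F_le_of_satisfiesAA (h : P.SatisfiesAA f₀) :
    ∃ D : ℕ, ∀ e, D ≤ e → P.F K e ≤ P.jA f₀ e ⊔ P.F K (e + 1) := by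
  classical
  obtain ⟨S, hS⟩ := (h : Module.Finite K (P.gr f₀)).fg_top
  obtain ⟨D, hD⟩ := (S.biUnion fun x => x.support).bddAbove
  refine ⟨D + 1, fun e he g hg => ?_⟩
  have hz : DirectSum.component K ℕ (P.grPiece f₀) e = 0 := by
    refine LinearMap.ext_on_range (v := ((↑) : S → P.gr f₀)) (by simpa using hS) fun x => ?_
    rw [LinearMap.zero_apply, ← DirectSum.apply_eq_component]
    by_contra hx
    have : e ∈ S.biUnion fun x => x.support :=
      Finset.mem_biUnion.2 ⟨x, x.2, DFinsupp.mem_support_iff.2 hx⟩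
    have := hD this
    omega
  have h1 := LinearMap.congr_fun hz
    (DirectSum.lof K ℕ (P.grPiece f₀) e (Submodule.Quotient.mk ⟨g, hg⟩))
  rw [DirectSum.component.lof_self, LinearMap.zero_apply, Submodule.Quotient.mk_eq_zero] at h1
  exact h1

/-- For `f₀ = 0` the filtration would be constant from `D` on, and would contain `x_1^D` in all its
members. -/
theorem ne_zero_of_satisfiesAA (hn : 1 ≤ n) (h : P.SatisfiesAA f₀) : f₀ ≠ 0 := by
  rintro rfl
  obtain ⟨D, hD⟩ := exists_F_le_of_satisfiesAA h
  have hj : ∀ e, P.jA (0 : MvPowerSeries (Fin n) K) e ≤ ⊥ := by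
    rintro e _ ⟨a, -, rfl⟩
    simp
  let α : Fin n →₀ ℕ := Finsupp.single ⟨0, hn⟩ D
  have hα : ∀ e, MvPowerSeries.monomial α (1 : K) ∈ P.F K (D + e) := fun e => by
    induction e with
    | zero =>
      refine mem_F_iff.2 (monomial_mem_shiftedF ?_ 1)
      have := P.degree_le_val α
      rw [add_zero]
      simpa [α] using this
    | succ e ih => exact sup_le ((hj _).trans bot_le) le_rfl (hD _ (Nat.le_add_right D e) ih)
  have h1 : MvPowerSeries.monomial α (1 : K) = 0 :=
    eq_zero_of_forall_mem_shiftedF (P := P) fun m =>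
      mem_F_iff.1 (F_anti (Nat.le_add_left m D) (hα m))
  have h2 := congrArg (MvPowerSeries.coeff α) h1
  simp at h2

theorem exists_of_mem_jA (hv : P.v f₀ = (d : ℤ)) (hg : g ∈ P.jA f₀ e) :
    ∃ a : Fin n → MvPowerSeries (Fin n) K,
      (∀ i, a i ∈ P.shiftedF K (-Pi.single i 1) (e - d)) ∧ der a f₀ = g := by
  obtain ⟨a, ha, rfl⟩ := hg
  refine ⟨a, coe_le_vDer_iff.1 ?_, rfl⟩
  rw [hv] at ha
  generalize P.vDer a = w at ha
  induction w using WithTop.recTopCoe with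
  | top => exact le_top
  | coe w =>
    rw [← WithTop.coe_add, WithTop.coe_le_coe] at ha
    rw [WithTop.coe_le_coe]
    linarith

theorem der_neg (a : Fin n → MvPowerSeries (Fin n) K) (g : MvPowerSeries (Fin n) K) :
    der (fun i => -a i) g = -der a g := by
  simp [der_apply]

/-- The quadratic remainder has value at least `d + 2(e - d) ≥ e + 1` because `e > d`, and `ξ(g -
f₀)` has value at least `(d + 1) + (e - d)`. -/
theorem substAdd_neg_sub_add_der_mem (hv : P.v f₀ = (d : ℤ)) (hg : g - f₀ ∈ P.F K (d + 1))
    (he : d < e) (ha : ∀ i, a i ∈ P.shiftedF K (-Pi.single i 1) (e - d)) :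
    substAdd (fun i => -a i) g - g + der a f₀ ∈ P.F K (e + 1) := by
  have hk : (0 : ℤ) < e - d := by omega
  rw [mem_F_iff] at hg ⊢
  have hf₀ : f₀ ∈ P.shiftedF K 0 d := coe_le_v_iff.1 hv.ge
  have hgd : g ∈ P.shiftedF K 0 d := by
    have := add_mem (shiftedF_anti (by push_cast; linarith) hg) hf₀
    rwa [sub_add_cancel] at this
  have h1 := substAdd_sub_self_sub_der_mem hk (fun i => neg_mem (ha i)) hgd
  have h2 := der_mem_shiftedF ha hg
  rw [der_neg] at h1
  have h3 := sub_mem (shiftedF_anti (by push_cast; omega : ((e + 1 : ℕ) : ℤ) ≤ _) h1)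
    (shiftedF_anti (by push_cast; omega : ((e + 1 : ℕ) : ℤ) ≤ _) h2)
  convert h3 using 1
  rw [map_sub]
  ring

/-- If `F_e ⊆ j_P^A(f₀)_e + F_{e+1}` for `e ≥ e₀`, then adding terms of value at least `e₀` to a
series with principal part `f₀` does not change its right equivalence class. -/
theorem rightEquiv_of_sub_mem {e₀ : ℕ} (hv : P.v f₀ = (d : ℤ)) (hf : f - f₀ ∈ P.F K (d + 1))
    (hd : d < e₀) (hD : ∀ e, e₀ ≤ e → P.F K e ≤ P.jA f₀ e ⊔ P.F K (e + 1))
    (hfg : g - f ∈ P.F K e₀) : RightEquiv f g := by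
  -- `b` describes the composite of the substitutions made so far; the fixed bound `1` survives in
  -- the limit.
  let Good : ℕ → (Fin n → MvPowerSeries (Fin n) K) → Prop := fun m b =>
    (∀ i, b i ∈ P.shiftedF K (-Pi.single i 1) 1) ∧ substAdd b g - f ∈ P.F K (e₀ + m)
  have step : ∀ m b, Good m b → ∃ b', Good (m + 1) b' ∧ ∀ i, b' i - b i ∈ P.shiftedF K 0 m := by
    rintro m b ⟨hb, hbg⟩
    obtain ⟨y, hy, z, hz, hyz⟩ := Submodule.mem_sup.1 (hD (e₀ + m) (Nat.le_add_right _ _) hbg)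
    obtain ⟨a, ha, rfl⟩ := exists_of_mem_jA hv hy
    have hlt : d < e₀ + m := by omega
    have hk : (0 : ℤ) < (e₀ + m : ℕ) - d := by omega
    have hna : ∀ i, -a i ∈ P.shiftedF K (-Pi.single i 1) ((e₀ + m : ℕ) - d) :=
      fun i => neg_mem (ha i)
    have hna1 : ∀ i, -a i ∈ P.shiftedF K (-Pi.single i 1) 1 :=
      fun i => shiftedF_anti (by omega) (hna i)
    have hg' : substAdd b g - f₀ ∈ P.F K (d + 1) := by
      have := add_mem (F_anti (by omega) hbg) hf
      rwa [sub_add_sub_cancel] at this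
    have h1 := substAdd_neg_sub_add_der_mem hv hg' hlt ha
    refine ⟨fun i => -a i + substAdd (fun i => -a i) (b i), ⟨fun i => ?_, ?_⟩, fun i => ?_⟩
    · exact add_mem (hna1 i) (substAdd_mem hk hna (hb i))
    · rw [← substAdd_substAdd one_pos hna1 hb, ← add_assoc]
      convert add_mem h1 hz using 1
      rw [eq_sub_of_add_eq' hyz]
      ring
    · have h2 := add_mem (hna i) (shiftedF_anti (by linarith) (substAdd_sub_self_mem hk hna (hb i)))
      rw [← add_sub_assoc] at h2
      exact shiftedF_anti (by omega) (shiftedF_single_le i h2)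
  choose! next hnext hclose using step
  let s : ℕ → Fin n → MvPowerSeries (Fin n) K := fun m => Nat.rec 0 next m
  have hs : ∀ m, Good m (s m) := fun m => by
    induction m with
    | zero =>
      refine ⟨fun i => zero_mem _, ?_⟩
      have : substAdd (0 : Fin n → MvPowerSeries (Fin n) K) g = g := by
        simp only [substAdd, Pi.zero_apply, add_zero]
        exact congrFun MvPowerSeries.subst_self g
      change substAdd 0 g - f ∈ _
      rwa [this]
    | succ m ih => exact hnext m _ ih
  choose b hb hb' using fun i => exists_limit (P := P) (fun m => s m i) fun m =>
    hclose m _ (hs m) i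
  -- Convergence holds for the unshifted filtration only; the shifted bound passes to the limit
  -- coefficient by coefficient.
  have hb1 : ∀ i, b i ∈ P.shiftedF K (-Pi.single i 1) 1 := fun i β hβ => by
    obtain ⟨m, hm⟩ := hb' i β
    exact (hs m).1 i β (hm ▸ hβ)
  have heq : substAdd b g = f := by
    rw [← sub_eq_zero]
    refine eq_zero_of_forall_mem_shiftedF (P := P) fun m => mem_F_iff.1 ?_
    have h1 := substAdd_sub_substAdd_mem one_pos hb1 (hs m).1
      (fun i => mem_F_iff.2 (hb i m)) g
    have := add_mem h1 (F_anti (Nat.le_add_left m e₀) (hs m).2)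
    rwa [sub_add_sub_cancel] at this
  rw [← heq]
  exact rightEquiv_substAdd one_pos hb1 g

/-- The corrections have value at least `e + m - d ≥ m`, so their sum converges to one derivation
`ξ` with `ξ f₀ = g`. -/
theorem F_le_jacobianIdeal {e₀ : ℕ} (hv : P.v f₀ = (d : ℤ))
    (hD : ∀ e, e₀ ≤ e → P.F K e ≤ P.jA f₀ e ⊔ P.F K (e + 1)) (he : e₀ ≤ e) (hde : d ≤ e) :
    P.F K e ≤ jacobianIdeal f₀ := by
  intro g hg
  have step : ∀ (m : ℕ) (b : Fin n → MvPowerSeries (Fin n) K), g - der b f₀ ∈ P.F K (e + m) →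
      ∃ b', g - der b' f₀ ∈ P.F K (e + (m + 1)) ∧ ∀ i, b' i - b i ∈ P.shiftedF K 0 m := by
    intro m b hb
    obtain ⟨y, hy, z, hz, hyz⟩ := Submodule.mem_sup.1 (hD (e + m) (by omega) hb)
    obtain ⟨a, ha, rfl⟩ := exists_of_mem_jA hv hy
    refine ⟨fun i => b i + a i, ?_, fun i => ?_⟩
    · rw [← add_assoc]
      convert hz using 1
      rw [eq_sub_of_add_eq' hyz, der_apply, der_apply, der_apply]
      simp only [add_mul, Finset.sum_add_distrib]
      ring
    · rw [add_sub_cancel_left]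
      exact shiftedF_anti (by push_cast; omega) (shiftedF_single_le i (ha i))
  choose! next hnext hclose using step
  let s : ℕ → Fin n → MvPowerSeries (Fin n) K := fun m => Nat.rec 0 next m
  have hs : ∀ m, g - der (s m) f₀ ∈ P.F K (e + m) := fun m => by
    induction m with
    | zero => simpa [s, der_apply] using hg
    | succ m ih => exact hnext m _ ih
  choose b hb _ using fun i => exists_limit (P := P) (fun m => s m i) fun m =>
    hclose m _ (hs m) i
  have heq : g = der b f₀ := by
    rw [← sub_eq_zero]
    refine eq_zero_of_forall_mem_shiftedF (P := P) fun m => mem_F_iff.1 ?_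
    have h1 : der b f₀ - der (s m) f₀ ∈ P.F K m := by
      rw [der_apply, der_apply, ← Finset.sum_sub_distrib]
      refine Ideal.sum_mem _ fun i _ => ?_
      rw [← sub_mul]
      exact Ideal.mul_mem_right _ _ (mem_F_iff.2 (hb i m))
    have := sub_mem (F_anti (Nat.le_add_left m e) (hs m)) h1
    rwa [sub_sub_sub_cancel_right] at this
  rw [heq, der_apply]
  exact Ideal.sum_mem _ fun i _ => Ideal.mul_mem_left _ _ (Ideal.subset_span ⟨i, rfl⟩)

theorem milnorNumber_lt_aleph0 (h : P.F K e ≤ jacobianIdeal f) :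
    milnorNumber f < Cardinal.aleph0 := by
  have hfin : Module.Finite K (MilnorAlgebra f) := by
    refine ⟨(Submodule.fg_def).2 ⟨(fun α => (jacobianIdeal f).mkQ
      (MvPowerSeries.monomial α (1 : K))) '' {α | P.val (expo α) < e},
      (P.finite_val_lt e).image _, ?_⟩⟩
    rw [eq_top_iff]
    rintro x -
    obtain ⟨g, rfl⟩ := Submodule.Quotient.mk_surjective _ x
    have h1 : (Submodule.Quotient.mk g : MilnorAlgebra f) =
        Submodule.Quotient.mk (P.truncVal e g) :=
      (Submodule.Quotient.eq _).2 (h (mem_F_iff.2 (sub_truncVal_mem e g)))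
    rw [h1, truncVal, ← Submodule.mkQ_apply, map_sum]
    refine Submodule.sum_mem _ fun α hα => ?_
    have h2 : (jacobianIdeal f).mkQ (MvPowerSeries.monomial α (MvPowerSeries.coeff α g)) =
        MvPowerSeries.coeff α g • (jacobianIdeal f).mkQ (MvPowerSeries.monomial α (1 : K)) := by
      rw [Submodule.mkQ_apply, Submodule.mkQ_apply, ← Submodule.Quotient.mk_smul, ← map_smul,
        smul_eq_mul, mul_one]
    rw [h2]
    exact Submodule.smul_mem _ _ (Submodule.subset_span ⟨α, by simpa using hα, rfl⟩)
  exact Module.rank_lt_aleph0 K _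

end CPolytope

/-! ### Monomial bases of the graded space and reduction to normal form. -/

namespace CPolytope

variable {n : ℕ} {P : CPolytope n} {K : Type*} [Field K] {d e : ℕ}
  {a b : Fin n → MvPowerSeries (Fin n) K} {f f₀ g : MvPowerSeries (Fin n) K}

theorem monomial_coeff_mem_F (hg : g ∈ P.F K e) (α : Fin n →₀ ℕ) :
    MvPowerSeries.monomial α (MvPowerSeries.coeff α g) ∈ P.F K e := by
  by_cases h : MvPowerSeries.coeff α g = 0
  · rw [h, map_zero]
    exact zero_mem _
  · exact mem_F_iff.2 (monomial_mem_shiftedF (mem_F_iff.1 hg α h) _)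

theorem of_mk_monomial {α : Fin n →₀ ℕ} (h : (P.val (expo α)).toNat = e) (c : K)
    (hc : MvPowerSeries.monomial α c ∈ P.F K e) :
    DirectSum.of (P.grPiece f₀) e (Submodule.Quotient.mk ⟨MvPowerSeries.monomial α c, hc⟩) =
      c • P.monomialClass f₀ α := by
  subst h
  rw [monomialClass, ← DirectSum.lof_eq_of K, ← DirectSum.lof_eq_of K, ← LinearMap.map_smul,
    ← Submodule.Quotient.mk_smul]
  refine congrArg _ (congrArg Submodule.Quotient.mk (Subtype.ext ?_))
  change _ = c • MvPowerSeries.monomial α (1 : K)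
  rw [← map_smul, smul_eq_mul, mul_one]

/-- Modulo `F_{e+1}`, an element of `F_e` is a finite sum of monomials of value exactly `e`. -/
theorem span_range_monomialClass (f₀ : MvPowerSeries (Fin n) K) :
    Submodule.span K (Set.range (P.monomialClass f₀)) = ⊤ := by
  classical
  rw [eq_top_iff]
  rintro x -
  induction x using DirectSum.induction_on with
  | zero => exact zero_mem _
  | add x y hx hy => exact add_mem hx hy
  | of e x =>
    obtain ⟨⟨g, hg⟩, rfl⟩ := Submodule.Quotient.mk_surjective _ x
    have h1 : (Submodule.Quotient.mk ⟨g, hg⟩ : P.grPiece f₀ e) =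
        ∑ α ∈ (P.finite_val_lt (e + 1)).toFinset,
          Submodule.Quotient.mk ⟨_, monomial_coeff_mem_F hg α⟩ := by
      simp only [← Submodule.mkQ_apply]
      rw [← map_sum, Submodule.mkQ_apply, Submodule.mkQ_apply, Submodule.Quotient.eq]
      refine Submodule.mem_sup_right ?_
      have h2 := mem_F_iff.2 (sub_truncVal_mem (P := P) ((e + 1 : ℕ) : ℤ) g)
      rw [truncVal] at h2
      simpa using h2
    rw [h1, map_sum]
    refine Submodule.sum_mem _ fun α hα => ?_
    have hα' : P.val (expo α) < e + 1 := by simpa using hα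
    by_cases h0 : MvPowerSeries.coeff α g = 0
    · have h2 : (⟨_, monomial_coeff_mem_F hg α⟩ : P.F K e) = 0 := by
        ext1
        simp [h0]
      rw [h2, Submodule.Quotient.mk_zero, map_zero]
      exact zero_mem _
    · have h2 := mem_F_iff.1 hg α h0
      rw [add_zero] at h2
      rw [of_mk_monomial (by omega)]
      exact Submodule.smul_mem _ _ (Submodule.subset_span ⟨α, rfl⟩)

/-- The projection of `gr_P^A(M_f)` to its part of degree `e`, seen in a quotient of `K[[x]]`. -/
noncomputable def grProj (P : CPolytope n) (f : MvPowerSeries (Fin n) K) (e : ℕ) :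
    P.gr f →ₗ[K] MvPowerSeries (Fin n) K ⧸ (P.jA f e ⊔ P.F K (e + 1)) :=
  (Submodule.mapQ ((P.jA f e ⊔ P.F K (e + 1)).submoduleOf (P.F K e)) (P.jA f e ⊔ P.F K (e + 1))
    (P.F K e).subtype le_rfl).restrictScalars K ∘ₗ DirectSum.component K ℕ (P.grPiece f) e

theorem grProj_of (hg : g ∈ P.F K e) :
    P.grProj f e (DirectSum.of (P.grPiece f) e (Submodule.Quotient.mk ⟨g, hg⟩)) =
      Submodule.Quotient.mk g := by
  rw [grProj, LinearMap.comp_apply, ← DirectSum.lof_eq_of K, DirectSum.component.lof_self]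
  rfl

theorem grProj_monomialClass (α : Fin n →₀ ℕ) :
    P.grProj f e (P.monomialClass f α) = if P.val (expo α) = e
      then Submodule.Quotient.mk (MvPowerSeries.monomial α (1 : K)) else 0 := by
  have h0 := P.val_expo_nonneg α
  split_ifs with h
  · obtain rfl : (P.val (expo α)).toNat = e := by omega
    rw [monomialClass, grProj_of]
  · rw [monomialClass, grProj, LinearMap.comp_apply, ← DirectSum.lof_eq_of K,
      DirectSum.component.of, dif_neg (by omega)]
    exact map_zero _

theorem exists_decomposition {Λ : Set (Fin n →₀ ℕ)}
    (hΛ : Submodule.span K (P.monomialClass f₀ '' Λ) = ⊤) (hg : g ∈ P.F K e) :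
    ∃ c : (Fin n →₀ ℕ) →₀ K, (∀ α ∈ c.support, α ∈ Λ ∧ P.val (expo α) = e) ∧
      g - c.sum (fun α r => MvPowerSeries.monomial α r) ∈ P.jA f₀ e ⊔ P.F K (e + 1) := by
  classical
  have h1 : DirectSum.of (P.grPiece f₀) e (Submodule.Quotient.mk ⟨g, hg⟩) ∈
      Submodule.span K (P.monomialClass f₀ '' Λ) := hΛ ▸ Submodule.mem_top
  rw [Finsupp.mem_span_image_iff_linearCombination] at h1
  obtain ⟨l, hl, hlg⟩ := h1
  -- The combination may involve other degrees, which the projection to degree `e` kills.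
  refine ⟨l.filter fun α => P.val (expo α) = e, fun α hα => ?_, ?_⟩
  · rw [Finsupp.support_filter, Finset.mem_filter] at hα
    exact ⟨(Finsupp.mem_supported _ _).1 hl hα.1, hα.2⟩
  · have h2 := congrArg (P.grProj f₀ e) hlg
    rw [grProj_of, Finsupp.linearCombination_apply, Finsupp.sum, map_sum] at h2
    refine (Submodule.Quotient.eq _).1 ?_
    rw [← h2, Finsupp.sum, Finsupp.support_filter, Finset.sum_filter, ← Submodule.mkQ_apply,
      map_sum]
    refine Finset.sum_congr rfl fun α _ => ?_
    rw [map_smul, grProj_monomialClass]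
    split_ifs with h
    · rw [Finsupp.filter_apply_pos (fun α => P.val (expo α) = e) l h, Submodule.mkQ_apply, ← Submodule.Quotient.mk_smul,
        ← map_smul, smul_eq_mul, mul_one]
    · rw [smul_zero, map_zero]

theorem exists_rightEquiv_sub_mem {Λ : Set (Fin n →₀ ℕ)} (hv : P.v f₀ = (d : ℤ))
    (hf : f - f₀ ∈ P.F K (d + 1)) (hΛ : Submodule.span K (P.monomialClass f₀ '' Λ) = ⊤) (m : ℕ) :
    ∃ (c : (Fin n →₀ ℕ) →₀ K) (g : MvPowerSeries (Fin n) K),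
      (∀ α ∈ c.support, α ∈ Λ ∧ (d : ℤ) < P.val (expo α)) ∧ RightEquiv f g ∧
        g - (f₀ + c.sum fun α r => MvPowerSeries.monomial α r) ∈ P.F K (d + 1 + m) := by
  classical
  induction m with
  | zero => exact ⟨0, f, by simp, rightEquiv_refl f, by simpa using hf⟩
  | succ m ih =>
    obtain ⟨c, g, hc, hfg, hg⟩ := ih
    obtain ⟨c', hc', hg'⟩ := exists_decomposition hΛ hg
    obtain ⟨y, hy, z, hz, hyz⟩ := Submodule.mem_sup.1 hg'
    obtain ⟨a, ha, rfl⟩ := exists_of_mem_jA hv hy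
    have hcF : (c.sum fun α r => MvPowerSeries.monomial α r) ∈ P.F K (d + 1) :=
      Ideal.sum_mem _ fun α hα => mem_F_iff.2 <| monomial_mem_shiftedF (by
        have := (hc α hα).2
        rw [add_zero]
        push_cast
        linarith) _
    have hgf : g - f₀ ∈ P.F K (d + 1) := by
      have := add_mem (F_anti (Nat.le_add_right _ _) hg) hcF
      convert this using 1
      ring
    -- The basis monomials of value `d + 1 + m` are kept in `c'`; the remaining part `ξ f₀` is
    -- removed by a substitution.
    have h1 := substAdd_neg_sub_add_der_mem hv hgf (by omega) ha
    refine ⟨c + c', substAdd (fun i => -a i) g, fun α hα => ?_, hfg.trans ?_, ?_⟩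
    · rcases Finset.mem_union.1 (Finsupp.support_add hα) with h | h
      · exact hc α h
      · refine ⟨(hc' α h).1, ?_⟩
        rw [(hc' α h).2]
        push_cast
        linarith
    · exact (rightEquiv_substAdd (k := ((d + 1 + m : ℕ) : ℤ) - d) (by push_cast; linarith)
        (fun i => neg_mem (ha i)) g).symm
    · rw [Finsupp.sum_add_index' (fun α => map_zero _) (fun α => map_add _), ← add_assoc]
      convert add_mem h1 hz using 1
      rw [eq_sub_of_add_eq' hyz]
      ring

end CPolytope

/-! ### The corollary. -/

theorem corollary4p5 {K : Type*} [Field K] [IsAlgClosed K] {n : ℕ} (hn : 1 ≤ n)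
    (P : CPolytope n) (f : MvPowerSeries (Fin n) K)
    (hf : f ∈ IsLocalRing.maximalIdeal (MvPowerSeries (Fin n) K))
    (hAA : P.SatisfiesAA (P.inP f)) :
    FinitelyRightDetermined f ∧ P.IsRSPH f ∧
      (∃ Λ : Set (Fin n →₀ ℕ), P.IsRegularBasis (P.inP f) Λ) ∧
      ∀ Λ : Set (Fin n →₀ ℕ), P.IsRegularBasis (P.inP f) Λ →
        ∃ (hΛ : Λ.Finite) (c : (Fin n →₀ ℕ) → K),
          RightEquiv f (P.inP f +
            ∑ α ∈ hΛ.toFinset with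
              P.v (P.inP f) < P.v (MvPowerSeries.monomial α (1 : K)),
              MvPowerSeries.monomial α (c α)) := by
  classical
  have hf₀ : f ≠ 0 := by
    rintro rfl
    refine CPolytope.ne_zero_of_satisfiesAA hn hAA (MvPowerSeries.ext fun α => ?_)
    rw [CPolytope.coeff_inP, map_zero, ite_self]
  obtain ⟨d, hv, hd⟩ := CPolytope.exists_v_inP_eq (P := P) hf₀
  obtain ⟨D, hD⟩ := CPolytope.exists_F_le_of_satisfiesAA hAA
  have hD' : ∀ e, D + d + 1 ≤ e → P.F K e ≤ P.jA (P.inP f) e ⊔ P.F K (e + 1) :=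
    fun e he => hD e (by omega)
  refine ⟨⟨D + d + 1, fun g hg => ?_⟩, ?_, ?_, fun Λ hΛ => ?_⟩
  · refine CPolytope.rightEquiv_of_sub_mem hv hd (by omega) hD' (CPolytope.mem_F_iff.2 ?_)
    intro β hβ
    rw [map_sub, sub_ne_zero] at hβ
    have h1 := P.degree_le_val β
    have h2 : ¬ β.degree ≤ D + d + 1 := fun h => hβ (hg β h)
    rw [add_zero]
    omega
  · exact CPolytope.milnorNumber_lt_aleph0
      (CPolytope.F_le_jacobianIdeal hv hD' le_rfl (by omega))
  · let : AddCommGroup (P.gr (P.inP f)) := Module.addCommMonoidToAddCommGroup K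
    obtain ⟨κ, i, hi, hspan, hli⟩ := exists_linearIndependent' K (P.monomialClass (P.inP f))
    refine ⟨Set.range i, ?_, ?_⟩
    · exact (linearIndependent_equiv' (Equiv.ofInjective i hi) rfl).1 hli
    · rw [← Set.range_comp, hspan, CPolytope.span_range_monomialClass]
  · have : Module.Finite K (P.gr (P.inP f)) := hAA
    have : Finite Λ := hΛ.1.finite
    have hfin : Λ.Finite := Set.toFinite Λ
    -- After `D` steps the error lies in `F_{D+d+1}`, where determinacy takes over.
    obtain ⟨c, g, hc, hfg, hg⟩ :=
      CPolytope.exists_rightEquiv_sub_mem hv hd hΛ.2 D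
    refine ⟨hfin, c, hfg.trans ?_⟩
    have hsum : (c.sum fun α r => MvPowerSeries.monomial α r) =
        ∑ α ∈ hfin.toFinset with P.v (P.inP f) < P.v (MvPowerSeries.monomial α (1 : K)),
          MvPowerSeries.monomial α (c α) := by
      refine Finset.sum_subset (fun α hα => ?_) fun α _ hα => ?_
      · rw [Finset.mem_filter, Set.Finite.mem_toFinset, hv, CPolytope.v_monomial]
        exact ⟨(hc α hα).1, WithTop.coe_lt_coe.2 (hc α hα).2⟩
      · exact (congrArg _ (Finsupp.notMem_support_iff.1 hα)).trans (map_zero _)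
    rw [← hsum]
    -- Determinacy is applied to the normal form, which also lies in `f₀ + F_{d+1}`.
    refine (CPolytope.rightEquiv_of_sub_mem (e₀ := D + d + 1) hv ?_ (by omega) hD' ?_).symm
    · rw [add_sub_cancel_left]
      refine Ideal.sum_mem _ fun α hα =>
        CPolytope.mem_F_iff.2 <| CPolytope.monomial_mem_shiftedF ?_ _
      have := (hc α hα).2
      rw [add_zero]
      push_cast
      linarith
    · rwa [show D + d + 1 = d + 1 + D by ring]
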